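/- Let $N\ge 2$, $1\le M\le N$, $0<\alpha<\beta<1$. Let $S=S^{N-1}\subset\mathbb R^N$ be the unit sphere, let $a_1,\dots,a_M$ be a basis of $\mathbb R^M$, where $\mathbb R^M$ is identified with $\mathbb R^M\times\{0\}\subset\mathbb R^N$, and let $$\mathcal L=\Bigl\{\sum_{i=1}^M k_i a_i : k\in\mathbb Z^M\Bigr\}\subset\mathbb R^N,\qquad \mathcal L_*=\mathcal L\setminus\{0\},\qquad c_0=\inf_{p\in\mathcal L_*}|p|\ (>0).$$ Let $\mathcal O=\{\varphi\in C^{1,\beta}(S):\|\varphi\|_{L^\infty(S)}<1\}$. For $\varphi\in\mathcal O$ put $F_\varphi(\sigma)=(1+\varphi(\sigma))\sigma$ for $\sigma\in S$, and $B_\varphi=\{rF_\varphi(\sigma):0\le r<1,\ \sigma\in S\}$. For $p\in\mathcal L_*$, $\tau\in(-\frac{c_0}{4},\frac{c_0}{4})$, $\varphi\in\mathcal O$ and $\theta\in S$ let $$G_p(\tau,\varphi)(\theta)=-\alpha\int_{B_\varphi}\frac{dy}{|\tau(y-F_\varphi(\theta))+p|^{N+\alpha}}.$$ Then, for every $p\in\mathcal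 L_*$, these integrals converge and define a map $$G_p:\Bigl(-\frac{c_0}{4},\frac{c_0}{4}\Bigr)\times\mathcal O\to C^{\beta-\alpha}(S)$$ which is of class $C^\infty$ (in the Fréchet sense, between the Banach spaces $\mathbb R\times C^{1,\beta}(S)$ and $C^{\beta-\alpha}(S)$). Moreover, for every $(\tau,\varphi)\in(-\frac{c_0}{4},\frac{c_0}{4})\times\mathcal O$ the series $\sum_{p\in\mathcal L_*}G_p(\tau,\varphi)$ converges (unconditionally) in $C^{\beta-\alpha}(S)$, and the map $$G=\sum_{p\in\mathcal L_*}G_p:\Bigl(-\frac{c_0}{4},\frac{c_0}{4}\Bigr)\times\mathcal O\to C^{\beta-\alpha}(S)$$ is of class $C^\infty$. -/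

import Mathlib

open MeasureTheory Set
open scoped ContDiff

noncomputable section

namespace NearSphere

/-- The ambient Euclidean space `ℝᴺ`. -/
abbrev E (N : ℕ) : Type := EuclideanSpace ℝ (Fin N)

/-- The unit sphere `S = S^{N-1} ⊂ ℝᴺ`, with the distance `|θ - σ|` of the ambient space. -/
abbrev S (N : ℕ) : Type := Metric.sphere (0 : E N) 1

/-- The supremum norm of a function on the sphere. -/
def supNorm {N : ℕ} {F : Type*} [Norm F] (f : S N → F) : ℝ := ⨆ θ, ‖f θ‖

/-! ### Facts on the supremum norm and Hölder functions -/

section Facts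

variable {N : ℕ} {F : Type*} [NormedAddCommGroup F]

theorem supNorm_nonneg (f : S N → F) : 0 ≤ supNorm f :=
  Real.iSup_nonneg fun _ => norm_nonneg _

theorem supNorm_smul [NormedSpace ℝ F] (c : ℝ) (f : S N → F) : supNorm (c • f) = ‖c‖ * supNorm f := by
  simp only [supNorm, Pi.smul_apply, norm_smul]
  exact (Real.mul_iSup_of_nonneg (norm_nonneg c) _).symm

theorem supNorm_add_le {f g : S N → F} (hf : BddAbove (range fun θ => ‖f θ‖))
    (hg : BddAbove (range fun θ => ‖g θ‖)) : supNorm (f + g) ≤ supNorm f + supNorm g :=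
  Real.iSup_le (fun θ => (norm_add_le _ _).trans
    (add_le_add (le_ciSup hf θ) (le_ciSup hg θ))) (add_nonneg (supNorm_nonneg f) (supNorm_nonneg g))

theorem eq_zero_of_supNorm_eq_zero {f : S N → F} (hf : BddAbove (range fun θ => ‖f θ‖))
    (h : supNorm f = 0) : f = 0 := by
  funext θ
  have h1 : ‖f θ‖ ≤ supNorm f := le_ciSup hf θ
  exact norm_le_zero_iff.1 (h1.trans h.le)

theorem dist_le_two (θ σ : S N) : dist θ σ ≤ 2 := by
  have h1 : ‖(θ : E N)‖ = 1 := by simp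
  have h2 : ‖(σ : E N)‖ = 1 := by simp
  rw [Subtype.dist_eq, dist_eq_norm]
  linarith [norm_sub_le (θ : E N) (σ : E N)]

theorem bddAbove_of_memHolder {r : NNReal} {f : S N → F} (hf : MemHolder r f) :
    BddAbove (range fun θ => ‖f θ‖) := by
  obtain ⟨C, hC⟩ := hf
  rcases isEmpty_or_nonempty (S N) with h | ⟨⟨σ⟩⟩
  · simp [range_eq_empty]
  · refine ⟨‖f σ‖ + C * 2 ^ (r : ℝ), ?_⟩
    rintro _ ⟨θ, rfl⟩
    have h1 : dist (f θ) (f σ) ≤ C * 2 ^ (r : ℝ) := (hC.dist_le θ σ).trans <| by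
      gcongr
      exact dist_le_two θ σ
    have h2 : ‖f θ‖ ≤ ‖f σ‖ + dist (f θ) (f σ) := by
      rw [dist_eq_norm]; exact norm_le_norm_add_norm_sub' _ _
    exact h2.trans (by linarith)

end Facts

/-! ### The Hölder space `C^γ(S)`, `γ ≥ 0` -/

/-- The functions `f : S → ℝ` with `|f θ - f σ| ≤ C |θ - σ|^γ` for some constant `C`. -/
def holderSubmodule (N : ℕ) (γ : ℝ) : Submodule ℝ (S N → ℝ) where
  carrier := {f | MemHolder γ.toNNReal f}
  zero_mem' := memHolder_zero
  add_mem' := fun hf hg => hf.add hg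
  smul_mem' := fun _ _ hf => hf.smul

/-- The Hölder space `C^γ(S)`. -/
def HolderSpace (N : ℕ) (γ : ℝ) : Type := holderSubmodule N γ

namespace HolderSpace

variable {N : ℕ} {γ : ℝ}

instance : AddCommGroup (HolderSpace N γ) := inferInstanceAs (AddCommGroup (holderSubmodule N γ))
instance : Module ℝ (HolderSpace N γ) := inferInstanceAs (Module ℝ (holderSubmodule N γ))
instance : CoeFun (HolderSpace N γ) fun _ => S N → ℝ := ⟨fun f => f.1⟩

/-- `‖f‖_{C^γ(S)} = sup |f| + sup_{θ ≠ σ} |f θ - f σ| / |θ - σ|^γ`. -/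
instance : Norm (HolderSpace N γ) :=
  ⟨fun f => supNorm (f : S N → ℝ) + nnHolderNorm γ.toNNReal (f : S N → ℝ)⟩

theorem norm_def (f : HolderSpace N γ) :
    ‖f‖ = supNorm (f : S N → ℝ) + nnHolderNorm γ.toNNReal (f : S N → ℝ) := rfl

theorem core (N : ℕ) (γ : ℝ) : NormedSpace.Core ℝ (HolderSpace N γ) where
  norm_nonneg f := add_nonneg (supNorm_nonneg _) NNReal.zero_le_coe
  norm_smul c f := by
    change supNorm (c • f.1) + nnHolderNorm γ.toNNReal (c • f.1) = _
    rw [supNorm_smul, MemHolder.nnHolderNorm_smul f.2 c, norm_def]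
    push_cast
    ring
  norm_triangle f g := by
    have h1 : supNorm (f.1 + g.1) ≤ supNorm f.1 + supNorm g.1 :=
      supNorm_add_le (bddAbove_of_memHolder f.2) (bddAbove_of_memHolder g.2)
    have h2 : (nnHolderNorm γ.toNNReal (f.1 + g.1) : ℝ) ≤
        nnHolderNorm γ.toNNReal f.1 + nnHolderNorm γ.toNNReal g.1 :=
      mod_cast MemHolder.nnHolderNorm_add_le f.2 g.2
    change supNorm (f.1 + g.1) + nnHolderNorm γ.toNNReal (f.1 + g.1) ≤ _
    rw [norm_def, norm_def]
    linarith
  norm_eq_zero_iff f := by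
    constructor
    · intro h
      have h1 := supNorm_nonneg f.1
      have h2 : (0 : ℝ) ≤ nnHolderNorm γ.toNNReal f.1 := NNReal.zero_le_coe
      rw [norm_def] at h
      exact Subtype.ext (eq_zero_of_supNorm_eq_zero (bddAbove_of_memHolder f.2) (by linarith))
    · rintro rfl
      change supNorm (0 : S N → ℝ) + nnHolderNorm γ.toNNReal (0 : S N → ℝ) = 0
      simp [supNorm]

instance : NormedAddCommGroup (HolderSpace N γ) := NormedAddCommGroup.ofCore (core N γ)
instance : NormedSpace ℝ (HolderSpace N γ) := NormedSpace.ofCore (core N γ)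

end HolderSpace

/-! ### The space `C^{1,β}(S)`, `0 < β` -/

/-- The extension `x ↦ φ (x / |x|)` of a function on the sphere to `ℝᴺ ∖ {0}` (with value `0` at
the origin, which plays no role). -/
def radialExt {N : ℕ} (φ : S N → ℝ) (x : E N) : ℝ :=
  if hx : x = 0 then 0 else φ ⟨‖x‖⁻¹ • x, by simp [norm_smul, hx]⟩

/-- The tangential gradient `∇φ(σ) ∈ T_σ S ⊂ ℝᴺ`: since `radialExt φ` is constant in the radial
direction, its gradient in `ℝᴺ` at a point of the sphere is the gradient of `φ` on the sphere. -/
def sphereGrad {N : ℕ} (φ : S N → ℝ) (σ : S N) : E N := gradient (radialExt φ) (σ : E N)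

theorem radialExt_add {N : ℕ} (φ ψ : S N → ℝ) :
    radialExt (φ + ψ) = radialExt φ + radialExt ψ := by
  funext x
  by_cases hx : x = 0 <;> simp [radialExt, hx]

theorem radialExt_smul {N : ℕ} (c : ℝ) (φ : S N → ℝ) :
    radialExt (c • φ) = c • radialExt φ := by
  funext x
  by_cases hx : x = 0 <;> simp [radialExt, hx]

theorem radialExt_zero {N : ℕ} : radialExt (0 : S N → ℝ) = 0 := by
  funext x
  by_cases hx : x = 0 <;> simp [radialExt, hx]

theorem radialExt_coe {N : ℕ} (φ : S N → ℝ) (σ : S N) : radialExt φ (σ : E N) = φ σ := by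
  have h1 : ‖(σ : E N)‖ = 1 := by simp
  have h0 : (σ : E N) ≠ 0 := by
    intro h
    simp [h] at h1
  simp [radialExt, h0]

/-- Differentiability of a function on the sphere, at every point. -/
def DiffOnSphere {N : ℕ} (φ : S N → ℝ) : Prop :=
  ∀ σ : S N, DifferentiableAt ℝ (radialExt φ) (σ : E N)

theorem sphereGrad_add {N : ℕ} {φ ψ : S N → ℝ} (hφ : DiffOnSphere φ) (hψ : DiffOnSphere ψ) :
    sphereGrad (φ + ψ) = sphereGrad φ + sphereGrad ψ := by
  funext σ
  simp only [sphereGrad, gradient, radialExt_add, Pi.add_apply]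
  rw [fderiv_add (hφ σ) (hψ σ), map_add]

theorem sphereGrad_smul {N : ℕ} (c : ℝ) {φ : S N → ℝ} (hφ : DiffOnSphere φ) :
    sphereGrad (c • φ) = c • sphereGrad φ := by
  funext σ
  simp only [sphereGrad, gradient, radialExt_smul, Pi.smul_apply]
  rw [fderiv_const_smul (hφ σ)]
  simp

theorem sphereGrad_zero {N : ℕ} : sphereGrad (0 : S N → ℝ) = 0 := by
  funext σ
  simp [sphereGrad, gradient, radialExt_zero]

theorem DiffOnSphere.bddAbove {N : ℕ} {φ : S N → ℝ} (hφ : DiffOnSphere φ) :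
    BddAbove (range fun θ => ‖φ θ‖) := by
  have hc : Continuous φ := by
    have h : φ = fun σ : S N => radialExt φ (σ : E N) := by
      funext σ
      rw [radialExt_coe]
    rw [h]
    exact continuous_iff_continuousAt.2 fun σ =>
      ContinuousAt.comp (f := fun σ : S N => (σ : E N)) (hφ σ).continuousAt
        continuous_subtype_val.continuousAt
  exact (isCompact_range hc.norm).bddAbove

/-- The functions on the sphere which are differentiable with `β`-Hölder tangential gradient. -/
def c1Submodule (N : ℕ) (β : ℝ) : Submodule ℝ (S N → ℝ) where
  carrier := {φ | DiffOnSphere φ ∧ MemHolder β.toNNReal (sphereGrad φ)}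
  zero_mem' := by
    refine ⟨fun σ => ?_, ?_⟩
    · rw [radialExt_zero]
      exact differentiableAt_const (0 : ℝ)
    · rw [sphereGrad_zero]
      exact memHolder_zero
  add_mem' := by
    rintro φ ψ ⟨h1, h2⟩ ⟨h3, h4⟩
    refine ⟨fun σ => ?_, ?_⟩
    · rw [radialExt_add]
      exact (h1 σ).add (h3 σ)
    · rw [sphereGrad_add h1 h3]
      exact h2.add h4
  smul_mem' := by
    rintro c φ ⟨h1, h2⟩
    refine ⟨fun σ => ?_, ?_⟩
    · rw [radialExt_smul]
      exact (h1 σ).const_smul c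
    · rw [sphereGrad_smul c h1]
      exact h2.smul

/-- The space `C^{1,β}(S)`. -/
def C1Space (N : ℕ) (β : ℝ) : Type := c1Submodule N β

namespace C1Space

variable {N : ℕ} {β : ℝ}

instance : AddCommGroup (C1Space N β) := inferInstanceAs (AddCommGroup (c1Submodule N β))
instance : Module ℝ (C1Space N β) := inferInstanceAs (Module ℝ (c1Submodule N β))
instance : CoeFun (C1Space N β) fun _ => S N → ℝ := ⟨fun f => f.1⟩

/-- `‖φ‖_{C^{1,β}(S)} = sup |φ| + sup |∇φ| + sup_{θ ≠ σ} |∇φ(θ) - ∇φ(σ)| / |θ - σ|^β`. -/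
instance : Norm (C1Space N β) :=
  ⟨fun φ => supNorm (φ : S N → ℝ) + supNorm (sphereGrad φ) +
    nnHolderNorm β.toNNReal (sphereGrad φ)⟩

theorem norm_def (φ : C1Space N β) :
    ‖φ‖ = supNorm (φ : S N → ℝ) + supNorm (sphereGrad φ) +
      nnHolderNorm β.toNNReal (sphereGrad φ) := rfl

theorem core (N : ℕ) (β : ℝ) : NormedSpace.Core ℝ (C1Space N β) where
  norm_nonneg f := add_nonneg (add_nonneg (supNorm_nonneg _) (supNorm_nonneg _))
    NNReal.zero_le_coe
  norm_smul c f := by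
    change supNorm (c • f.1) + supNorm (sphereGrad (c • f.1)) +
      nnHolderNorm β.toNNReal (sphereGrad (c • f.1)) = _
    rw [sphereGrad_smul c f.2.1, supNorm_smul, supNorm_smul,
      MemHolder.nnHolderNorm_smul f.2.2 c, norm_def]
    push_cast
    ring
  norm_triangle f g := by
    have h1 : supNorm (f.1 + g.1) ≤ supNorm f.1 + supNorm g.1 :=
      supNorm_add_le f.2.1.bddAbove g.2.1.bddAbove
    have h2 : supNorm (sphereGrad f.1 + sphereGrad g.1) ≤
        supNorm (sphereGrad f.1) + supNorm (sphereGrad g.1) :=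
      supNorm_add_le (bddAbove_of_memHolder f.2.2) (bddAbove_of_memHolder g.2.2)
    have h3 : (nnHolderNorm β.toNNReal (sphereGrad f.1 + sphereGrad g.1) : ℝ) ≤
        nnHolderNorm β.toNNReal (sphereGrad f.1) + nnHolderNorm β.toNNReal (sphereGrad g.1) :=
      mod_cast MemHolder.nnHolderNorm_add_le f.2.2 g.2.2
    change supNorm (f.1 + g.1) + supNorm (sphereGrad (f.1 + g.1)) +
      nnHolderNorm β.toNNReal (sphereGrad (f.1 + g.1)) ≤ _
    rw [norm_def, norm_def, sphereGrad_add f.2.1 g.2.1]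
    linarith
  norm_eq_zero_iff f := by
    constructor
    · intro h
      have h1 := supNorm_nonneg f.1
      have h2 := supNorm_nonneg (sphereGrad f.1)
      have h3 : (0 : ℝ) ≤ nnHolderNorm β.toNNReal (sphereGrad f.1) := NNReal.zero_le_coe
      rw [norm_def] at h
      exact Subtype.ext (eq_zero_of_supNorm_eq_zero f.2.1.bddAbove (by linarith))
    · rintro rfl
      change supNorm (0 : S N → ℝ) + supNorm (sphereGrad (0 : S N → ℝ)) +
        nnHolderNorm β.toNNReal (sphereGrad (0 : S N → ℝ)) = 0
      simp [supNorm, sphereGrad_zero]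

instance : NormedAddCommGroup (C1Space N β) := NormedAddCommGroup.ofCore (core N β)
instance : NormedSpace ℝ (C1Space N β) := NormedSpace.ofCore (core N β)

end C1Space

/-! ### Perturbed spheres -/

/-- `𝒪 = {φ ∈ C^{1,β}(S) : ‖φ‖_∞ < 1}`. -/
def 𝒪 (N : ℕ) (β : ℝ) : Set (C1Space N β) := {φ | supNorm (φ : S N → ℝ) < 1}

/-- `F_φ(σ) = (1 + φ(σ)) σ`. -/
def Fmap {N : ℕ} (φ : S N → ℝ) (σ : S N) : E N := (1 + φ σ) • (σ : E N)

/-- `B_φ = {r F_φ(σ) : 0 ≤ r < 1, σ ∈ S}`. -/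
def Bset {N : ℕ} (φ : S N → ℝ) : Set (E N) :=
  {y | ∃ r : ℝ, ∃ σ : S N, 0 ≤ r ∧ r < 1 ∧ y = r • Fmap φ σ}

/-! ### Lattices -/

/-- The identification of `x' ∈ ℝᴹ` with `(x', 0) ∈ ℝᴺ`, for `M ≤ N`. -/
def embed {M : ℕ} (N : ℕ) (x : E M) : E N :=
  WithLp.toLp 2 fun j : Fin N => if h : (j : ℕ) < M then x ⟨j, h⟩ else 0

/-- The lattice `𝓛 = {∑ kᵢ aᵢ : k ∈ ℤᴹ}`, as a subset of `ℝᴺ`. -/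
def lattice {M : ℕ} (N : ℕ) (a : Module.Basis (Fin M) ℝ (E M)) : Set (E N) :=
  range fun k : Fin M → ℤ => embed N (∑ i, (k i : ℝ) • a i)

/-- `𝓛_* = 𝓛 ∖ {0}`. -/
def latticeStar {M : ℕ} (N : ℕ) (a : Module.Basis (Fin M) ℝ (E M)) : Set (E N) :=
  lattice N a \ {0}

/-- `c₀ = inf_{p ∈ 𝓛_*} |p|`. -/
def c₀ {M : ℕ} (N : ℕ) (a : Module.Basis (Fin M) ℝ (E M)) : ℝ :=
  ⨅ p : latticeStar N a, ‖(p : E N)‖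

/-! ### The operators -/

/-- The integrand `y ↦ |τ (y - F_φ(θ)) + p|^{-(N+α)}`. -/
def kernel {N : ℕ} (α : ℝ) (p : E N) (τ : ℝ) (φ : S N → ℝ) (θ : S N) (y : E N) : ℝ :=
  1 / ‖τ • (y - Fmap φ θ) + p‖ ^ ((N : ℝ) + α)

/-- `G_p(τ, φ)(θ) = -α ∫_{B_φ} |τ (y - F_φ(θ)) + p|^{-(N+α)} dy`. -/
def Gval {N : ℕ} (α : ℝ) (p : E N) (τ : ℝ) (φ : S N → ℝ) (θ : S N) : ℝ :=
  -α * ∫ y in Bset φ, kernel α p τ φ θ y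

/-- The domain `(-c₀/4, c₀/4) × 𝒪`. -/
def domain {M : ℕ} (N : ℕ) (β : ℝ) (a : Module.Basis (Fin M) ℝ (E M)) :
    Set (ℝ × C1Space N β) :=
  Ioo (-(c₀ N a / 4)) (c₀ N a / 4) ×ˢ 𝒪 N β

end NearSphere

end

noncomputable section

namespace NearSphere

open NormedSpace Topology

/-! ### The logarithm in a commutative Banach algebra -/

section BanachLog

variable {B : Type*} [NormedCommRing B] [NormedAlgebra ℝ B] [CompleteSpace B]

/-! No differentiation under the integral sign or of the series is needed: all terms factor as `G_p
= T_p ∘ K`, with one nonlinear smooth map `K` and continuous linear maps `T_p`.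

Polar coordinates `y = t F_φ(σ)` turn the integral over `B_φ` into one over the fixed space `S ×
[0,1]` with weight `(1+φ(σ))^N t^{N-1}` (`setIntegral_Bset`). The target of `K` is the Banach
algebra of bounded continuous maps from the parameters `(p, σ, t)` to `C^γ(S)`, the functions of
`θ`, with `γ = β - α`. There `|τ(t F_φ(σ) - F_φ(θ)) + p|² / |p|²` is a polynomial in `τ` and
continuous linear images of `φ`, so it is smooth in `(τ, φ)`. Since `|y - F_φ(θ)| ≤ 4` and `|τ| <
c₀/4`, it is bounded below by a positive constant, uniformly in all parameters including `p`.

The power `-(N+α)/2` of such a family is `exp(s log)`. In a commutative Banach algebra the inverse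
function theorem inverts `exp` smoothly near any exponential (`contDiffAt_invFun_exp`); `exp` is
injective because evaluations are continuous homomorphisms to `ℝ`. This makes `K` smooth
(`contDiffAt_kernelFamily`).

`T_p` integrates over `(σ, t)` and has norm at most `C |p|^{-(N+α)}`. This is summable over a
lattice of rank `M ≤ N`, so `∑ T_p` converges in operator norm and `G = (∑ T_p) ∘ K`. -/

theorem contDiff_normedSpace_exp : ContDiff ℝ ∞ (exp : B → B) :=
  contDiff_iff_contDiffAt.2 fun x => (exp_analytic (𝕂 := ℝ) x).contDiffAt

/-- The derivative of the exponential at `x`, as a continuous linear equivalence. -/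
def expDerivEquiv (x : B) : B ≃L[ℝ] B :=
  ContinuousLinearEquiv.equivOfInverse (exp x • (1 : B →L[ℝ] B)) (exp (-x) • (1 : B →L[ℝ] B))
    (fun y => by
      let _ : NormedAlgebra ℚ B := NormedAlgebra.restrictScalars ℚ ℝ B
      simp [← mul_assoc, ← exp_add])
    (fun y => by
      let _ : NormedAlgebra ℚ B := NormedAlgebra.restrictScalars ℚ ℝ B
      simp [← mul_assoc, ← exp_add])

/-- If the exponential of a commutative Banach algebra is injective, then its inverse is smooth on
its range. -/
theorem contDiffAt_invFun_exp (hinj : Function.Injective (exp : B → B)) (x : B) :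
    ContDiffAt ℝ ∞ (Function.invFun (exp : B → B)) (exp x) := by
  have h1 : ContDiffAt ℝ ∞ (exp : B → B) x := contDiff_normedSpace_exp.contDiffAt
  have h2 : HasStrictFDerivAt (exp : B → B) (expDerivEquiv x : B →L[ℝ] B) x :=
    hasStrictFDerivAt_exp (𝕂 := ℝ)
  have h3 := h1.to_localInverse h2.hasFDerivAt (by simp)
  -- Near `exp x` the local inverse is a right inverse of `exp`; injectivity forces it to agree
  -- there with the global `Function.invFun`.
  refine h3.congr_of_eventuallyEq ?_
  filter_upwards [(h1.hasStrictFDerivAt' h2.hasFDerivAt (by simp)).eventually_right_inverse]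
    with y hy
  apply hinj
  rw [Function.invFun_eq ⟨_, hy⟩]
  exact hy.symm

end BanachLog

/-! ### The Hölder space as a Banach algebra -/

namespace HolderSpace

variable {N : ℕ} {γ : ℝ}

@[ext] theorem ext {f g : HolderSpace N γ} (h : ∀ θ, f θ = g θ) : f = g :=
  Subtype.ext (funext h)

theorem sub_apply (f g : HolderSpace N γ) (θ : S N) : (f - g) θ = f θ - g θ := rfl

theorem abs_apply_le (f : HolderSpace N γ) (θ : S N) : |f θ| ≤ supNorm (f : S N → ℝ) :=
  le_ciSup (bddAbove_of_memHolder f.2) θ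

theorem abs_apply_le_norm (f : HolderSpace N γ) (θ : S N) : |f θ| ≤ ‖f‖ :=
  (f.abs_apply_le θ).trans (by rw [norm_def]; linarith [(nnHolderNorm γ.toNNReal (f : S N → ℝ)).2])

theorem abs_sub_le (f : HolderSpace N γ) (θ σ : S N) :
    |f θ - f σ| ≤ nnHolderNorm γ.toNNReal (f : S N → ℝ) * dist θ σ ^ (γ.toNNReal : ℝ) := by
  have := (MemHolder.holderWith f.2).dist_le θ σ
  rwa [Real.dist_eq] at this

theorem abs_sub_le_norm (f : HolderSpace N γ) (θ σ : S N) :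
    |f θ - f σ| ≤ ‖f‖ * dist θ σ ^ (γ.toNNReal : ℝ) :=
  (f.abs_sub_le θ σ).trans <| by
    gcongr
    rw [norm_def]; linarith [supNorm_nonneg (f : S N → ℝ)]

theorem holderWith_of_abs_sub_le {f : S N → ℝ} {C : ℝ} (hC : 0 ≤ C)
    (h : ∀ θ σ, |f θ - f σ| ≤ C * dist θ σ ^ (γ.toNNReal : ℝ)) :
    HolderWith C.toNNReal γ.toNNReal f := by
  intro θ σ
  rw [edist_dist, edist_dist, Real.dist_eq,
    ENNReal.ofReal_rpow_of_nonneg dist_nonneg NNReal.zero_le_coe,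
    ← ENNReal.ofReal, ← ENNReal.ofReal_mul hC]
  exact ENNReal.ofReal_le_ofReal (h θ σ)

/-- A Hölder function from an explicit bound on its increments. -/
def mk (f : S N → ℝ) (C : ℝ) (hC : 0 ≤ C)
    (h : ∀ θ σ, |f θ - f σ| ≤ C * dist θ σ ^ (γ.toNNReal : ℝ)) : HolderSpace N γ :=
  ⟨f, (holderWith_of_abs_sub_le hC h).memHolder⟩

@[simp] theorem mk_apply (f : S N → ℝ) (C : ℝ) (hC : 0 ≤ C)
    (h : ∀ θ σ, |f θ - f σ| ≤ C * dist θ σ ^ (γ.toNNReal : ℝ)) (θ : S N) :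
    (mk f C hC h : HolderSpace N γ) θ = f θ := rfl

theorem norm_le_add {f : HolderSpace N γ} {C₁ C₂ : ℝ} (h₁ : 0 ≤ C₁) (h₂ : 0 ≤ C₂)
    (hs : ∀ θ, |f θ| ≤ C₁)
    (hd : ∀ θ σ, |f θ - f σ| ≤ C₂ * dist θ σ ^ (γ.toNNReal : ℝ)) : ‖f‖ ≤ C₁ + C₂ := by
  rw [norm_def]
  refine add_le_add (Real.iSup_le hs h₁) ?_
  rw [← Real.coe_toNNReal C₂ h₂]
  exact_mod_cast (holderWith_of_abs_sub_le h₂ hd).nnholderNorm_le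

theorem abs_mul_sub_mul_le (f g : HolderSpace N γ) (θ σ : S N) :
    |f θ * g θ - f σ * g σ| ≤ (supNorm (f : S N → ℝ) * nnHolderNorm γ.toNNReal (g : S N → ℝ) +
      nnHolderNorm γ.toNNReal (f : S N → ℝ) * supNorm (g : S N → ℝ)) *
        dist θ σ ^ (γ.toNNReal : ℝ) := by
  have h : f θ * g θ - f σ * g σ = f θ * (g θ - g σ) + (f θ - f σ) * g σ := by ring
  rw [h]
  refine (abs_add_le _ _).trans ?_
  rw [abs_mul, abs_mul]
  calc _ ≤ supNorm (f : S N → ℝ) *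
        (nnHolderNorm γ.toNNReal (g : S N → ℝ) * dist θ σ ^ (γ.toNNReal : ℝ)) +
        (nnHolderNorm γ.toNNReal (f : S N → ℝ) * dist θ σ ^ (γ.toNNReal : ℝ)) *
          supNorm (g : S N → ℝ) :=
        add_le_add
          (mul_le_mul (f.abs_apply_le θ) (g.abs_sub_le θ σ) (abs_nonneg _) (supNorm_nonneg _))
          (mul_le_mul (f.abs_sub_le θ σ) (g.abs_apply_le σ) (abs_nonneg _)
            (mul_nonneg NNReal.zero_le_coe (by positivity)))
    _ = _ := by ring

scoped instance : Mul (HolderSpace N γ) where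
  mul f g := mk (fun θ => f θ * g θ) _
    (add_nonneg (mul_nonneg (supNorm_nonneg _) NNReal.zero_le_coe)
      (mul_nonneg NNReal.zero_le_coe (supNorm_nonneg _))) (abs_mul_sub_mul_le f g)

scoped instance : One (HolderSpace N γ) where
  one := mk (fun _ => 1) 0 le_rfl (by simp)

@[simp] theorem mul_apply (f g : HolderSpace N γ) (θ : S N) : (f * g) θ = f θ * g θ := rfl
@[simp] theorem one_apply (θ : S N) : (1 : HolderSpace N γ) θ = 1 := rfl

scoped instance : NormedCommRing (HolderSpace N γ) :=
  { (inferInstance : NormedAddCommGroup (HolderSpace N γ)) with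
    mul := (· * ·)
    one := 1
    left_distrib := fun f g h => ext fun θ => mul_add (f θ) (g θ) (h θ)
    right_distrib := fun f g h => ext fun θ => add_mul (f θ) (g θ) (h θ)
    zero_mul := fun f => ext fun θ => zero_mul (f θ)
    mul_zero := fun f => ext fun θ => mul_zero (f θ)
    mul_assoc := fun f g h => ext fun θ => mul_assoc (f θ) (g θ) (h θ)
    one_mul := fun f => ext fun θ => one_mul (f θ)
    mul_one := fun f => ext fun θ => mul_one (f θ)
    mul_comm := fun f g => ext fun θ => mul_comm (f θ) (g θ)
    norm_mul_le := fun f g => by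
      have hf := supNorm_nonneg (f : S N → ℝ)
      have hg := supNorm_nonneg (g : S N → ℝ)
      have hf' : (0 : ℝ) ≤ nnHolderNorm γ.toNNReal (f : S N → ℝ) := NNReal.zero_le_coe
      have hg' : (0 : ℝ) ≤ nnHolderNorm γ.toNNReal (g : S N → ℝ) := NNReal.zero_le_coe
      refine (norm_le_add (mul_nonneg hf hg)
        (add_nonneg (mul_nonneg hf hg') (mul_nonneg hf' hg)) (fun θ => ?_)
        (abs_mul_sub_mul_le f g)).trans ?_
      · rw [mul_apply, abs_mul]
        exact mul_le_mul (f.abs_apply_le θ) (g.abs_apply_le θ) (abs_nonneg _) hf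
      -- `‖f‖ ‖g‖` exceeds the bound by the product of the two Hölder seminorms.
      · rw [norm_def, norm_def]
        nlinarith [mul_nonneg hf' hg'] }

scoped instance : Algebra ℝ (HolderSpace N γ) :=
  Algebra.ofModule (fun c f g => ext fun θ => mul_assoc c (f θ) (g θ))
    (fun c f g => ext fun θ => mul_left_comm (f θ) c (g θ))

scoped instance : NormedAlgebra ℝ (HolderSpace N γ) where
  norm_smul_le c f := (norm_smul c f).le

/-- Needed for the exponential series, the inverse function theorem and the Bochner integral. The
limit is pointwise; the norm bounds involve at most two points at a time, so they survive it. -/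
instance : CompleteSpace (HolderSpace N γ) := by
  refine Metric.complete_of_cauchySeq_tendsto fun u hu => ?_
  have hpt : ∀ θ, ∃ l, Filter.Tendsto (fun n => u n θ) Filter.atTop (𝓝 l) := fun θ => by
    refine cauchySeq_tendsto_of_complete (Metric.cauchySeq_iff'.2 fun ε hε => ?_)
    obtain ⟨n, hn⟩ := Metric.cauchySeq_iff'.1 hu ε hε
    refine ⟨n, fun m hm => lt_of_le_of_lt ?_ (hn m hm)⟩
    rw [Real.dist_eq, dist_eq_norm, ← sub_apply]
    exact abs_apply_le_norm _ θ
  choose f hf using hpt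
  have hC : ∃ C, 0 ≤ C ∧ ∀ n, ‖u n‖ ≤ C := by
    obtain ⟨R, hR, h⟩ := cauchySeq_bdd hu
    refine ⟨‖u 0‖ + R, by positivity, fun n => ?_⟩
    have := h n 0
    rw [dist_eq_norm] at this
    linarith [norm_le_norm_add_norm_sub' (u n) (u 0)]
  obtain ⟨C, hC0, hC⟩ := hC
  let g : HolderSpace N γ := mk f C hC0 fun θ σ =>
    le_of_tendsto (((hf θ).sub (hf σ)).abs) (Filter.Eventually.of_forall fun n =>
      ((u n).abs_sub_le_norm θ σ).trans (by gcongr; exact hC n))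
  refine ⟨g, Metric.tendsto_atTop'.2 fun ε hε => ?_⟩
  -- Supremum and seminorm each cost `ε / 3`; limits preserve only `≤`, and the spare third restores
  -- strictness.
  obtain ⟨n, hn⟩ := Metric.cauchySeq_iff.1 hu (ε / 3) (by positivity)
  refine ⟨n, fun k hk => ?_⟩
  rw [dist_eq_norm]
  have h3 : (0 : ℝ) ≤ ε / 3 := by positivity
  have hkm : ∀ m ≥ n, ‖u k - u m‖ ≤ ε / 3 := fun m hm => by
    rw [← dist_eq_norm]; exact (hn k hk.le m hm).le
  refine (norm_le_add h3 h3 (fun θ => ?_) fun θ σ => ?_).trans_lt (by linarith : ε / 3 + ε / 3 < ε)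
  · refine le_of_tendsto ((tendsto_const_nhds (x := u k θ)).sub (hf θ)).abs ?_
    filter_upwards [Filter.eventually_ge_atTop n] with m hm
    exact (abs_apply_le_norm (u k - u m) θ).trans (hkm m hm)
  · refine le_of_tendsto (((tendsto_const_nhds (x := u k θ)).sub (hf θ)).sub
      ((tendsto_const_nhds (x := u k σ)).sub (hf σ))).abs ?_
    filter_upwards [Filter.eventually_ge_atTop n] with m hm
    exact (abs_sub_le_norm (u k - u m) θ σ).trans (by gcongr; exact hkm m hm)

/-- Evaluation at a point of the sphere, as a homomorphism of algebras. -/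
def evalHom (γ : ℝ) (θ : S N) : HolderSpace N γ →ₐ[ℝ] ℝ where
  toFun f := f θ
  map_one' := rfl
  map_mul' _ _ := rfl
  map_zero' := rfl
  map_add' _ _ := rfl
  commutes' c := mul_one c

theorem continuous_evalHom (θ : S N) : Continuous (evalHom γ θ) :=
  AddMonoidHomClass.continuous_of_bound (evalHom γ θ) 1 fun f => by
    rw [one_mul]; exact f.abs_apply_le_norm θ

/-- Evaluation at a point of the sphere, as a continuous linear form. -/
def evalCLM (γ : ℝ) (θ : S N) : HolderSpace N γ →L[ℝ] ℝ :=
  ⟨(evalHom γ θ).toLinearMap, continuous_evalHom θ⟩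

/-- A continuous algebra homomorphism, here evaluation at `θ`, commutes with the exponential series.
-/
theorem exp_apply (f : HolderSpace N γ) (θ : S N) : (exp f) θ = Real.exp (f θ) := by
  let _ : NormedAlgebra ℚ (HolderSpace N γ) := NormedAlgebra.restrictScalars ℚ ℝ _
  rw [Real.exp_eq_exp_ℝ]
  exact map_exp (evalHom γ θ) (continuous_evalHom θ) f

theorem exp_injective : Function.Injective (exp : HolderSpace N γ → HolderSpace N γ) :=
  fun f g h => ext fun θ => Real.exp_injective <| by rw [← exp_apply, ← exp_apply, h]

end HolderSpace

end NearSphere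
end

noncomputable section

namespace NearSphere

open NormedSpace Topology BoundedContinuousFunction
open scoped HolderSpace

/-! ### Logarithms and powers of uniformly positive functions -/

theorem abs_log_sub_log_le {δ a b : ℝ} (hδ : 0 < δ) (ha : δ ≤ a) (hb : δ ≤ b) :
    |Real.log a - Real.log b| ≤ δ⁻¹ * |a - b| := by
  wlog h : b ≤ a generalizing a b
  · rw [abs_sub_comm, abs_sub_comm a]
    exact this hb ha (le_of_not_ge h)
  have hb0 : 0 < b := hδ.trans_le hb
  have ha0 : 0 < a := hδ.trans_le ha
  rw [abs_of_nonneg (sub_nonneg.2 (Real.log_le_log hb0 h)), abs_of_nonneg (sub_nonneg.2 h),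
    ← Real.log_div ha0.ne' hb0.ne']
  calc Real.log (a / b) ≤ a / b - 1 := Real.log_le_sub_one_of_pos (by positivity)
    _ = b⁻¹ * (a - b) := by field_simp
    _ ≤ δ⁻¹ * (a - b) := by
      have := sub_nonneg.2 h
      gcongr

namespace HolderSpace

variable {N : ℕ} {γ : ℝ}

/-- The preimage is the pointwise logarithm, which is Lipschitz on `[δ, ∞)`. The explicit norm bound
keeps logarithms of whole families bounded. -/
theorem exists_exp_eq {f : HolderSpace N γ} {δ : ℝ} (hδ : 0 < δ) (h : ∀ θ, δ ≤ f θ) :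
    ∃ g : HolderSpace N γ, exp g = f ∧ ‖g‖ ≤ (|Real.log δ| + ‖f‖) + δ⁻¹ * ‖f‖ := by
  have hd : ∀ θ σ, |Real.log (f θ) - Real.log (f σ)| ≤
      (δ⁻¹ * ‖f‖) * dist θ σ ^ (γ.toNNReal : ℝ) := fun θ σ => by
    refine (abs_log_sub_log_le hδ (h θ) (h σ)).trans ?_
    rw [mul_assoc]
    gcongr
    exact f.abs_sub_le_norm θ σ
  have h0 : 0 ≤ δ⁻¹ * ‖f‖ := by positivity
  refine ⟨mk (fun θ => Real.log (f θ)) _ h0 hd, ?_, ?_⟩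
  · ext θ
    rw [exp_apply, mk_apply, Real.exp_log (hδ.trans_le (h θ))]
  · refine norm_le_add (by positivity) h0 (fun θ => ?_) hd
    rw [mk_apply, abs_le]
    have h1 := Real.log_le_log hδ (h θ)
    have h2 := Real.log_le_sub_one_of_pos (hδ.trans_le (h θ))
    have h3 := (le_abs_self _).trans (f.abs_apply_le_norm θ)
    have h4 := neg_abs_le (Real.log δ)
    have h5 := abs_nonneg (Real.log δ)
    have h6 := norm_nonneg f
    constructor <;> linarith

end HolderSpace

section Powers

variable {N : ℕ} {γ : ℝ} {X : Type*} [TopologicalSpace X]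

/-- Evaluation of a bounded continuous family of Hölder functions. -/
def evalFamily (γ : ℝ) (x : X) (θ : S N) : (X →ᵇ HolderSpace N γ) →ₐ[ℝ] ℝ where
  toFun R := R x θ
  map_one' := rfl
  map_mul' _ _ := rfl
  map_zero' := rfl
  map_add' _ _ := rfl
  commutes' c := mul_one c

theorem continuous_evalFamily (x : X) (θ : S N) :
    Continuous (evalFamily γ x θ : (X →ᵇ HolderSpace N γ) → ℝ) :=
  (HolderSpace.continuous_evalHom θ).comp (continuous_eval_const (F := X →ᵇ HolderSpace N γ) x)

theorem exp_family_apply (R : X →ᵇ HolderSpace N γ) (x : X) (θ : S N) :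
    (exp R) x θ = Real.exp (R x θ) := by
  let _ : NormedAlgebra ℚ (X →ᵇ HolderSpace N γ) := NormedAlgebra.restrictScalars ℚ ℝ _
  rw [Real.exp_eq_exp_ℝ]
  exact map_exp (evalFamily γ x θ) (continuous_evalFamily x θ) R

theorem exp_family_injective :
    Function.Injective (exp : (X →ᵇ HolderSpace N γ) → (X →ᵇ HolderSpace N γ)) :=
  fun f g h => by
    ext x θ
    exact Real.exp_injective <| by rw [← exp_family_apply, ← exp_family_apply, h]

/-- The logarithm is taken separately at each parameter. Its continuity in the parameter, as a map
into `C^γ`, comes from that of the inverse exponential on `C^γ`, and its boundedness from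
`HolderSpace.exists_exp_eq`. -/
theorem exists_exp_family_eq {R : X →ᵇ HolderSpace N γ} {δ : ℝ} (hδ : 0 < δ)
    (h : ∀ x θ, δ ≤ R x θ) : ∃ L : X →ᵇ HolderSpace N γ, exp L = R := by
  choose g hg hgn using fun x => HolderSpace.exists_exp_eq hδ (h x)
  have hinv : g = fun x => Function.invFun exp (R x) := funext fun x =>
    HolderSpace.exp_injective (by rw [Function.invFun_eq ⟨_, hg x⟩, hg x])
  have hc : Continuous g := by
    rw [hinv]
    refine continuous_iff_continuousAt.2 fun x => ?_
    have h1 := (contDiffAt_invFun_exp HolderSpace.exp_injective (g x)).continuousAt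
    rw [hg x] at h1
    exact ContinuousAt.comp (f := fun x => R x) h1 R.continuous.continuousAt
  refine ⟨BoundedContinuousFunction.ofNormedAddCommGroup g hc
    ((|Real.log δ| + ‖R‖) + δ⁻¹ * ‖R‖) fun x => (hgn x).trans ?_, ?_⟩
  · gcongr <;> exact R.norm_coe_le_norm x
  · ext x θ
    rw [exp_family_apply, ← hg x, HolderSpace.exp_apply]
    rfl

/-- The power `R ^ s` of a uniformly positive family of Hölder functions. -/
def familyRpow (s : ℝ) (R : X →ᵇ HolderSpace N γ) : X →ᵇ HolderSpace N γ :=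
  exp (s • Function.invFun exp R)

theorem familyRpow_apply {R : X →ᵇ HolderSpace N γ} {δ : ℝ} (hδ : 0 < δ)
    (h : ∀ x θ, δ ≤ R x θ) (s : ℝ) (x : X) (θ : S N) : familyRpow s R x θ = R x θ ^ s := by
  have h1 := exists_exp_family_eq hδ h
  have h2 : (exp (Function.invFun exp R)) x θ = R x θ := by rw [Function.invFun_eq h1]
  rw [exp_family_apply] at h2
  rw [familyRpow, exp_family_apply, ← h2, ← Real.exp_mul, mul_comm]
  rfl

theorem contDiffAt_familyRpow {R : X →ᵇ HolderSpace N γ} {δ : ℝ} (hδ : 0 < δ)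
    (h : ∀ x θ, δ ≤ R x θ) (s : ℝ) : ContDiffAt ℝ ∞ (familyRpow (X := X) (γ := γ) (N := N) s) R := by
  obtain ⟨L, rfl⟩ := exists_exp_family_eq hδ h
  exact contDiff_normedSpace_exp.contDiffAt.comp _
    ((contDiffAt_invFun_exp exp_family_injective L).const_smul s)

end Powers

/-! ### The embedding of `C^{1,β}(S)` into Hölder spaces -/

section Embedding

variable {N : ℕ} {β γ : ℝ}

namespace C1Space

theorem abs_apply_le (φ : C1Space N β) (θ : S N) : |φ θ| ≤ supNorm (φ : S N → ℝ) :=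
  le_ciSup φ.2.1.bddAbove θ

theorem abs_apply_le_norm (φ : C1Space N β) (θ : S N) : |φ θ| ≤ ‖φ‖ :=
  (φ.abs_apply_le θ).trans <| by
    rw [norm_def]
    linarith [supNorm_nonneg (sphereGrad φ), (nnHolderNorm β.toNNReal (sphereGrad φ)).2]

theorem norm_sphereGrad_le (φ : C1Space N β) (θ : S N) : ‖sphereGrad φ θ‖ ≤ ‖φ‖ :=
  (show _ ≤ supNorm (sphereGrad φ) from le_ciSup (bddAbove_of_memHolder φ.2.2) θ).trans <| by
    rw [norm_def]
    linarith [supNorm_nonneg (φ : S N → ℝ), (nnHolderNorm β.toNNReal (sphereGrad φ)).2]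

end C1Space

theorem radialExt_smul_arg (φ : S N → ℝ) {c : ℝ} (hc : 0 < c) (x : E N) :
    radialExt φ (c • x) = radialExt φ x := by
  by_cases hx : x = 0
  · simp [hx]
  · have hcx : c • x ≠ 0 := smul_ne_zero hc.ne' hx
    rw [radialExt, radialExt, dif_neg hcx, dif_neg hx]
    congr 2
    rw [norm_smul, Real.norm_of_nonneg hc.le, smul_smul]
    congr 1
    field_simp

/-- Homogeneity of degree zero: rescaling by the frozen factor `‖x‖⁻¹` does not change `radialExt φ`
and moves `x` to the sphere, so differentiability there spreads to all nonzero points. -/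
theorem hasFDerivAt_radialExt {φ : S N → ℝ} (hφ : DiffOnSphere φ) {x : E N} (hx : x ≠ 0) :
    ∃ σ : S N, HasFDerivAt (radialExt φ) (‖x‖⁻¹ • fderiv ℝ (radialExt φ) (σ : E N)) x := by
  have hc : 0 < ‖x‖⁻¹ := inv_pos.2 (norm_pos_iff.2 hx)
  refine ⟨⟨‖x‖⁻¹ • x, by simp [norm_smul, hx]⟩, ?_⟩
  have h1 := (hφ ⟨‖x‖⁻¹ • x, by simp [norm_smul, hx]⟩).hasFDerivAt
  have h2 : HasFDerivAt (fun y : E N => ‖x‖⁻¹ • y) (‖x‖⁻¹ • ContinuousLinearMap.id ℝ (E N)) x :=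
    (‖x‖⁻¹ • ContinuousLinearMap.id ℝ (E N)).hasFDerivAt
  have h3 := HasFDerivAt.comp x h1 h2
  have h4 : radialExt φ ∘ (fun y : E N => ‖x‖⁻¹ • y) = radialExt φ :=
    funext fun y => radialExt_smul_arg φ hc y
  rw [h4] at h3
  simpa using h3

/-- Chords leave the sphere, so for nearby points the mean value inequality is applied to the radial
extension on a ball of radius `1/2`, where `‖x‖ ≥ 1/2` bounds its gradient by `2‖φ‖`. For points
further apart than `1/2`, the trivial bound `2‖φ‖` is enough; this gives the constant 4. -/
theorem C1Space.abs_sub_le (φ : C1Space N β) (θ σ : S N) : |φ θ - φ σ| ≤ 4 * ‖φ‖ * dist θ σ := by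
  have hn := norm_nonneg φ
  rcases le_or_gt (dist θ σ) (1 / 2) with h | h
  · have hs : ‖(σ : E N)‖ = 1 := by simp
    have key : ∀ x ∈ Metric.closedBall (σ : E N) (1 / 2), x ≠ 0 ∧ ‖x‖⁻¹ ≤ 2 := fun x hx => by
      rw [Metric.mem_closedBall, dist_eq_norm] at hx
      have h1 : 1 / 2 ≤ ‖x‖ := by
        have := norm_sub_norm_le (σ : E N) x
        rw [norm_sub_rev] at this
        linarith
      refine ⟨norm_pos_iff.1 (by linarith), ?_⟩
      rw [inv_le_comm₀ (by linarith) (by norm_num)]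
      linarith
    have hmv := (convex_closedBall (σ : E N) (1 / 2)).norm_image_sub_le_of_norm_fderiv_le (𝕜 := ℝ)
      (f := radialExt (φ : S N → ℝ)) (C := 2 * ‖φ‖)
      (x := (σ : E N)) (y := (θ : E N))
      (fun x hx => by
        obtain ⟨ρ, hρ⟩ := hasFDerivAt_radialExt φ.2.1 (key x hx).1
        exact hρ.differentiableAt)
      (fun x hx => by
        obtain ⟨ρ, hρ⟩ := hasFDerivAt_radialExt φ.2.1 (key x hx).1
        rw [hρ.fderiv, norm_smul, norm_inv, norm_norm]
        have h1 : ‖fderiv ℝ (radialExt (φ : S N → ℝ)) (ρ : E N)‖ = ‖sphereGrad φ ρ‖ := by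
          rw [sphereGrad, gradient, LinearIsometryEquiv.norm_map]
        rw [h1]
        exact mul_le_mul (key x hx).2 (φ.norm_sphereGrad_le ρ) (norm_nonneg _) (by norm_num))
      (Metric.mem_closedBall_self (by norm_num)) (by rwa [Metric.mem_closedBall])
    rw [radialExt_coe, radialExt_coe, Real.norm_eq_abs, ← dist_eq_norm, ← Subtype.dist_eq] at hmv
    refine hmv.trans ?_
    gcongr
    norm_num
  · have h1 := abs_sub (φ θ) (φ σ)
    have h2 := φ.abs_apply_le_norm θ
    have h3 := φ.abs_apply_le_norm σ
    nlinarith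

theorem dist_le_two_mul_rpow {r : ℝ} (h0 : 0 ≤ r) (h1 : r ≤ 1) (θ σ : S N) :
    dist θ σ ≤ 2 * dist θ σ ^ r := by
  rcases (dist_nonneg (x := θ) (y := σ)).eq_or_lt with h | h
  · rw [← h]; positivity
  · calc dist θ σ = dist θ σ ^ (1 - r) * dist θ σ ^ r := by
          rw [← Real.rpow_add h]; simp
      _ ≤ 2 * dist θ σ ^ r := by
          gcongr
          calc dist θ σ ^ (1 - r) ≤ 2 ^ (1 - r) :=
                Real.rpow_le_rpow h.le (dist_le_two θ σ) (by linarith)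
            _ ≤ 2 ^ (1 : ℝ) := Real.rpow_le_rpow_of_exponent_le (by norm_num) (by linarith)
            _ = 2 := by simp

theorem holder_of_lipschitz (hγ : γ ≤ 1) {f : S N → ℝ} {C : ℝ} (hC : 0 ≤ C)
    (h : ∀ θ σ, |f θ - f σ| ≤ C * dist θ σ) (θ σ : S N) :
    |f θ - f σ| ≤ (C * 2) * dist θ σ ^ (γ.toNNReal : ℝ) := by
  refine (h θ σ).trans ?_
  rw [mul_assoc]
  gcongr
  refine dist_le_two_mul_rpow NNReal.zero_le_coe ?_ θ σ
  exact_mod_cast Real.toNNReal_le_one.2 hγ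

/-- The inclusion `C^{1,β}(S) → C^γ(S)`, for `γ ≤ 1`. -/
def inclusion (N : ℕ) (β : ℝ) (hγ : γ ≤ 1) : C1Space N β →L[ℝ] HolderSpace N γ :=
  LinearMap.mkContinuous
    { toFun := fun φ => HolderSpace.mk (φ : S N → ℝ) _ (by positivity)
        (holder_of_lipschitz hγ (by positivity) φ.abs_sub_le)
      map_add' := fun _ _ => rfl
      -- `9 = 1 + 4 · 2`: the supremum, plus the Lipschitz constant times the factor from `dist ≤ 2
      -- dist^γ`.
      map_smul' := fun _ _ => rfl } 9 fun φ => by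
    refine (HolderSpace.norm_le_add (norm_nonneg φ) (by positivity) φ.abs_apply_le_norm
      (holder_of_lipschitz hγ (by positivity) φ.abs_sub_le)).trans ?_
    linarith [norm_nonneg φ]

/-- The coordinate functions on the sphere. -/
def coordFun (hγ : γ ≤ 1) (j : Fin N) : HolderSpace N γ :=
  HolderSpace.mk (fun θ => (θ : E N) j) (1 * 2) (by norm_num)
    (holder_of_lipschitz hγ zero_le_one fun θ σ => by
      rw [one_mul, Subtype.dist_eq, dist_eq_norm]
      exact PiLp.norm_apply_le ((θ : E N) - (σ : E N)) j)

@[simp] theorem coordFun_apply (hγ : γ ≤ 1) (j : Fin N) (θ : S N) :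
    (coordFun hγ j : HolderSpace N γ) θ = (θ : E N) j := rfl

end Embedding

end NearSphere
end

noncomputable section

namespace NearSphere

open Topology

/-! ### The lattice -/

theorem norm_embed {M N : ℕ} (h : M ≤ N) (x : E M) : ‖embed N x‖ = ‖x‖ := by
  obtain ⟨k, rfl⟩ := Nat.exists_eq_add_of_le h
  rw [EuclideanSpace.norm_eq, EuclideanSpace.norm_eq, Fin.sum_univ_add]
  simp [embed]

/-- Since `embed` is an isometry, this is a sum over a `ℤ`-lattice of rank `M` in `ℝᴹ`, convergent
because `N + α > M`. -/
theorem summable_latticeStar_rpow {M N : ℕ} (h : M ≤ N) {α : ℝ} (hα : 0 < α)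
    (a : Module.Basis (Fin M) ℝ (E M)) :
    Summable fun p : latticeStar N a => ‖(p : E N)‖ ^ (-((N : ℝ) + α)) := by
  have hrank : Module.finrank ℤ (Submodule.span ℤ (range a)) = M := by
    rw [ZLattice.rank ℝ (Submodule.span ℤ (range a))]
    simp
  have hs := ZLattice.summable_norm_rpow (Submodule.span ℤ (range a)) (-((N : ℝ) + α)) (by
    rw [hrank]
    have : (M : ℝ) ≤ N := by exact_mod_cast h
    linarith)
  have hex : ∀ p : latticeStar N a, ∃ x : Submodule.span ℤ (range a), embed N (x : E M) = p :=
    fun p => by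
      obtain ⟨k, hk⟩ := p.2.1
      refine ⟨⟨∑ i, (k i : ℝ) • a i, Submodule.sum_mem _ fun i _ => ?_⟩, hk⟩
      rw [Int.cast_smul_eq_zsmul]
      exact Submodule.smul_mem _ _ (Submodule.subset_span (mem_range_self i))
  choose e he using hex
  have hinj : Function.Injective e := fun p q hpq => Subtype.ext (by rw [← he, ← he, hpq])
  refine (hs.comp_injective hinj).congr fun p => ?_
  simp only [Function.comp_apply]
  rw [← he p, norm_embed h]
  rfl

theorem c₀_le_norm {M N : ℕ} (a : Module.Basis (Fin M) ℝ (E M)) (p : latticeStar N a) :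
    c₀ N a ≤ ‖(p : E N)‖ :=
  ciInf_le ⟨0, by rintro _ ⟨q, rfl⟩; exact norm_nonneg _⟩ p

/-- Discreteness is read off from summability with exponent `N + 1`: no term exceeds the total `T`,
so `‖p‖ ≥ T^{-1/(N+1)}`. -/
theorem c₀_pos {M N : ℕ} (hM : 1 ≤ M) (h : M ≤ N) (a : Module.Basis (Fin M) ℝ (E M)) :
    0 < c₀ N a := by
  have hpos : ∀ p : latticeStar N a, 0 < ‖(p : E N)‖ := fun p => norm_pos_iff.2 p.2.2
  have hs := summable_latticeStar_rpow h one_pos a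
  have hs0 : (0 : ℝ) < N + 1 := by positivity
  let p₀ : latticeStar N a := ⟨embed N (a ⟨0, hM⟩), ⟨Pi.single ⟨0, hM⟩ 1, by
    simp [Pi.single_apply]⟩, by
      rw [mem_singleton_iff, ← norm_eq_zero, norm_embed h, norm_eq_zero]
      exact a.ne_zero _⟩
  have : Nonempty (latticeStar N a) := ⟨p₀⟩
  set T := ∑' p : latticeStar N a, ‖(p : E N)‖ ^ (-((N : ℝ) + 1)) with hT
  have hle : ∀ p : latticeStar N a, ‖(p : E N)‖ ^ (-((N : ℝ) + 1)) ≤ T := fun p =>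
    hs.le_tsum p fun q _ => by positivity
  have hT0 : 0 < T := (Real.rpow_pos_of_pos (hpos p₀) _).trans_le (hle p₀)
  refine (Real.rpow_pos_of_pos hT0 (-((N : ℝ) + 1))⁻¹).trans_le (le_ciInf fun p => ?_)
  rw [Real.rpow_inv_le_iff_of_neg hT0 (hpos p) (by linarith)]
  exact hle p

/-- The distance of `τ (y - w) + p` from the origin is comparable with `|p|`. -/
theorem mul_norm_le_norm_smul_sub_add {N : ℕ} {p y w : E N} {c τ : ℝ} (hc : 0 < c) (hp : c ≤ ‖p‖)
    (hy : ‖y‖ ≤ 2) (hw : ‖w‖ ≤ 2) : (1 - 4 * |τ| / c) * ‖p‖ ≤ ‖τ • (y - w) + p‖ := by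
  have h1 : ‖τ • (y - w)‖ ≤ |τ| * 4 := by
    rw [norm_smul, Real.norm_eq_abs]
    gcongr
    linarith [norm_sub_le y w]
  have h2 : ‖p‖ - ‖τ • (y - w)‖ ≤ ‖τ • (y - w) + p‖ := by
    have := norm_sub_le (τ • (y - w) + p) (τ • (y - w))
    rw [add_sub_cancel_left] at this
    linarith
  have h3 : |τ| * 4 ≤ 4 * |τ| / c * ‖p‖ := by
    rw [div_mul_eq_mul_div, le_div_iff₀ hc]
    nlinarith [abs_nonneg τ]
  linarith

/-! ### The perturbed balls in polar coordinates -/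

section Polar

variable {N : ℕ} {φ : S N → ℝ}

/-- On the ray through `σ` the set is `r < 1 + φ σ`; this form yields both measurability and the
polar integration range. -/
theorem mem_Bset_iff (hN : 1 ≤ N) (hφ : ∀ σ, |φ σ| < 1) (y : E N) :
    y ∈ Bset φ ↔ ‖y‖ < 1 + radialExt φ y := by
  have hpos : ∀ σ, 0 < 1 + φ σ := fun σ => by linarith [(abs_lt.1 (hφ σ)).1]
  have : Nontrivial (E N) := by
    have : Nonempty (Fin N) := ⟨⟨0, hN⟩⟩
    infer_instance
  constructor
  · rintro ⟨r, σ, h0, h1, rfl⟩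
    have hn : ‖r • Fmap φ σ‖ = r * (1 + φ σ) := by
      rw [Fmap, norm_smul, norm_smul, Real.norm_of_nonneg h0, Real.norm_of_nonneg (hpos σ).le]
      simp
    rw [hn]
    rcases h0.eq_or_lt with rfl | h0
    -- At the origin the default value `0` of `radialExt` makes the condition `0 < 1`.
    · simp [radialExt]
    · rw [Fmap, smul_smul, radialExt_smul_arg φ (mul_pos h0 (hpos σ)), radialExt_coe]
      nlinarith [hpos σ]
  · intro h
    by_cases hy : y = 0
    · obtain ⟨σ⟩ : Nonempty (S N) := (NormedSpace.sphere_nonempty.2 zero_le_one).to_subtype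
      exact ⟨0, σ, le_rfl, one_pos, by simp [hy]⟩
    · rw [radialExt, dif_neg hy] at h
      have hy' : ‖y‖ ≠ 0 := norm_ne_zero_iff.2 hy
      refine ⟨‖y‖ / (1 + φ ⟨‖y‖⁻¹ • y, by simp [norm_smul, hy]⟩), ⟨‖y‖⁻¹ • y,
        by simp [norm_smul, hy]⟩, div_nonneg (norm_nonneg _) (hpos _).le,
        (div_lt_one (hpos _)).2 h, ?_⟩
      rw [Fmap, smul_smul, smul_smul, div_mul_cancel₀ _ (hpos _).ne', mul_inv_cancel₀ hy', one_smul]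

theorem norm_Fmap_le (hφ : ∀ σ, |φ σ| < 1) (σ : S N) : ‖Fmap φ σ‖ ≤ 2 := by
  rw [Fmap, norm_smul, Real.norm_eq_abs]
  have := abs_lt.1 (hφ σ)
  rw [abs_of_pos (by linarith)]
  simp
  linarith

theorem norm_le_of_mem_Bset (hφ : ∀ σ, |φ σ| < 1) {y : E N} (hy : y ∈ Bset φ) : ‖y‖ ≤ 2 := by
  obtain ⟨r, σ, h0, h1, rfl⟩ := hy
  rw [norm_smul, Real.norm_of_nonneg h0]
  nlinarith [norm_Fmap_le hφ σ, norm_nonneg (Fmap φ σ)]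

theorem measurableSet_Bset (hN : 1 ≤ N) (hd : DiffOnSphere φ) (hφ : ∀ σ, |φ σ| < 1) :
    MeasurableSet (Bset φ) := by
  have h1 : Bset φ = {y | ‖y‖ < 1 + radialExt φ y} := Set.ext fun y => mem_Bset_iff hN hφ y
  have h2 : Measurable (radialExt φ) :=
    measurable_of_continuousOn_compl_singleton 0 fun x hx =>
      (hasFDerivAt_radialExt hd hx).choose_spec.continuousAt.continuousWithinAt
  rw [h1]
  exact measurableSet_lt measurable_norm (measurable_const.add h2)

theorem volume_Bset_lt_top (hφ : ∀ σ, |φ σ| < 1) : volume (Bset φ) < ⊤ :=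
  (measure_mono fun _ hy => mem_closedBall_zero_iff.2 (norm_le_of_mem_Bset hφ hy)).trans_lt
    (measure_closedBall_lt_top (x := (0 : E N)) (r := 2))

/-- The surface measure of the sphere times the Lebesgue measure of the unit interval. -/
def coneMeasure (N : ℕ) : Measure (S N × unitInterval) :=
  (volume : Measure (E N)).toSphere.prod volume

instance : IsFiniteMeasure (coneMeasure N) :=
  inferInstanceAs (IsFiniteMeasure ((volume : Measure (E N)).toSphere.prod volume))

/-- Substitution `r = c t`: `n` factors of `c` come from the density `r^n` and one from `dr`. The
range becomes independent of `c`. -/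
theorem integral_radial_indicator {k : ℝ → ℝ} {c : ℝ} (hc : 0 < c) (n : ℕ) :
    ∫ r : Ioi (0 : ℝ), (Iio c).indicator k r ∂Measure.volumeIoiPow n =
      ∫ t : unitInterval, c ^ (n + 1) * (t : ℝ) ^ n * k (t * c) := by
  have h1 : ∫ r : Ioi (0 : ℝ), (Iio c).indicator k r ∂Measure.volumeIoiPow n =
      ∫ r in Ioi (0 : ℝ), r ^ n * (Iio c).indicator k r := by
    simp only [Measure.volumeIoiPow, ENNReal.ofReal]
    rw [integral_withDensity_eq_integral_smul,
      integral_subtype_comap measurableSet_Ioi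
        fun r => Real.toNNReal (r ^ n) • (Iio c).indicator k r,
      setIntegral_congr_fun measurableSet_Ioi fun x hx => ?_]
    · rw [NNReal.smul_def, Real.coe_toNNReal _ (pow_nonneg (le_of_lt hx) _), smul_eq_mul]
    · exact (measurable_subtype_coe.pow_const _).real_toNNReal
  have h2 := integral_comp_mul_left_Ioi (fun r => r ^ n * (Iio c).indicator k r) 0 hc
  rw [mul_zero, smul_eq_mul] at h2
  have h3 : ∫ r in Ioi (0 : ℝ), r ^ n * (Iio c).indicator k r =
      c * ∫ t in Ioi (0 : ℝ), (c * t) ^ n * (Iio c).indicator k (c * t) := by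
    rw [h2, ← mul_assoc, mul_inv_cancel₀ hc.ne', one_mul]
  have h4 : ∀ t ∈ Ioi (0 : ℝ), c * ((c * t) ^ n * (Iio c).indicator k (c * t)) =
      (Iio 1).indicator (fun t => c ^ (n + 1) * t ^ n * k (t * c)) t := fun t _ => by
    by_cases ht : t < 1
    · rw [indicator_of_mem (show t ∈ Iio 1 from ht), indicator_of_mem]
      · rw [mul_comm t c]; ring
      · exact mem_Iio.2 (by nlinarith)
    · rw [indicator_of_notMem (show t ∉ Iio 1 from ht), indicator_of_notMem]
      · ring
      · rw [mem_Iio]; push Not at ht ⊢; nlinarith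
  rw [h1, h3, ← integral_const_mul, setIntegral_congr_fun measurableSet_Ioi h4,
    setIntegral_indicator measurableSet_Iio, Ioi_inter_Iio,
    ← integral_Icc_eq_integral_Ioo]
  exact (integral_subtype_comap measurableSet_Icc fun t => c ^ (n + 1) * t ^ n * k (t * c)).symm

/-- Moves the dependence on `φ` from the domain of integration into the integrand, where it is
accessible to algebra. -/
theorem setIntegral_Bset (hN : 1 ≤ N) (hd : DiffOnSphere φ) (hφ : ∀ σ, |φ σ| < 1)
    {k : E N → ℝ} (hk : IntegrableOn k (Bset φ))
    (hk' : Integrable (fun x : S N × unitInterval =>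
      (1 + φ x.1) ^ N * (x.2 : ℝ) ^ (N - 1) * k ((x.2 : ℝ) • Fmap φ x.1)) (coneMeasure N)) :
    ∫ y in Bset φ, k y = ∫ x : S N × unitInterval,
      (1 + φ x.1) ^ N * (x.2 : ℝ) ^ (N - 1) * k ((x.2 : ℝ) • Fmap φ x.1) ∂coneMeasure N := by
  have hpos : ∀ σ, 0 < 1 + φ σ := fun σ => by linarith [(abs_lt.1 (hφ σ)).1]
  have hB := measurableSet_Bset hN hd hφ
  have hmp := (volume : Measure (E N)).measurePreserving_homeomorphUnitSphereProd
  have hemb := (homeomorphUnitSphereProd (E N)).symm.measurableEmbedding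
  have hsymm : MeasurePreserving (homeomorphUnitSphereProd (E N)).symm
      ((volume : Measure (E N)).toSphere.prod (.volumeIoiPow (Module.finrank ℝ (E N) - 1)))
      (volume.comap Subtype.val) :=
    MeasurePreserving.symm (homeomorphUnitSphereProd (E N)).toMeasurableEquiv hmp
  set g : E N → ℝ := (Bset φ).indicator k with hg
  have hgi : Integrable g := (integrable_indicator_iff hB).2 hk
  have hgi0 : Integrable (fun y : ({0}ᶜ : Set (E N)) => g y) (volume.comap Subtype.val) :=
    (integrableOn_iff_comap_subtypeVal (measurableSet_singleton _).compl).1 hgi.integrableOn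
  have h1 : ∫ y, g y = ∫ y : ({0}ᶜ : Set (E N)), g y ∂(volume.comap Subtype.val) := by
    -- Positive dimension makes the origin, which polar coordinates omit, a null set.
    have : Nontrivial (E N) := by
      have : Nonempty (Fin N) := ⟨⟨0, hN⟩⟩
      infer_instance
    rw [integral_subtype_comap (measurableSet_singleton _).compl g,
      restrict_compl_singleton]
  rw [← integral_indicator hB, ← hg, h1, ← hsymm.integral_comp hemb, integral_prod, coneMeasure,
    integral_prod _ hk']
  · refine integral_congr_ae (Filter.Eventually.of_forall fun σ => ?_)
    have h2 := integral_radial_indicator (k := fun r => k (r • (σ : E N))) (hpos σ) (N - 1)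
    have h3 : Module.finrank ℝ (E N) = N := by simp
    rw [Nat.sub_add_cancel hN] at h2
    simp only [h3]
    refine Eq.trans (integral_congr_ae (Filter.Eventually.of_forall fun r => ?_))
      (h2.trans (integral_congr_ae (Filter.Eventually.of_forall fun t => ?_)))
    · have hr : (0 : ℝ) < r := r.2
      simp only [homeomorphUnitSphereProd_symm_apply_coe, hg]
      have h4 : (r : ℝ) • (σ : E N) ∈ Bset φ ↔ (r : ℝ) ∈ Iio (1 + φ σ) := by
        rw [mem_Bset_iff hN hφ, radialExt_smul_arg φ hr, radialExt_coe, norm_smul,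
          Real.norm_of_nonneg hr.le]
        simp
      by_cases h5 : (r : ℝ) ∈ Iio (1 + φ σ)
      · rw [indicator_of_mem h5, indicator_of_mem (h4.2 h5)]
      · rw [indicator_of_notMem h5, indicator_of_notMem (mt h4.1 h5)]
    · simp only [Fmap, smul_smul]
  · exact (hsymm.integrable_comp_emb hemb).2 hgi0

end Polar

/-! ### The kernel -/

theorem integrableOn_kernel {N : ℕ} (hN : 1 ≤ N) {φ : S N → ℝ} (hd : DiffOnSphere φ)
    (hφ : ∀ σ, |φ σ| < 1) {α c τ : ℝ} (hα : 0 < α) {p : E N} (hc : 0 < c) (hp : c ≤ ‖p‖)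
    (hτ : |τ| < c / 4) (θ : S N) : IntegrableOn (kernel α p τ φ θ) (Bset φ) := by
  have hδ : 0 < 1 - 4 * |τ| / c := by
    rw [sub_pos, div_lt_one hc]; linarith
  have hδp : 0 < (1 - 4 * |τ| / c) * ‖p‖ := mul_pos hδ (hc.trans_le hp)
  have hm : Measurable (kernel α p τ φ θ) := by
    unfold kernel
    fun_prop
  refine Measure.integrableOn_of_bounded (M := 1 / ((1 - 4 * |τ| / c) * ‖p‖) ^ ((N : ℝ) + α))
    (volume_Bset_lt_top hφ).ne hm.aestronglyMeasurable ?_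
  filter_upwards [ae_restrict_mem (measurableSet_Bset hN hd hφ)] with y hy
  have h1 := mul_norm_le_norm_smul_sub_add (τ := τ) hc hp (norm_le_of_mem_Bset hφ hy)
    (norm_Fmap_le hφ θ)
  rw [kernel, Real.norm_of_nonneg (by positivity)]
  gcongr

end NearSphere
end

noncomputable section

namespace NearSphere

open Topology BoundedContinuousFunction
open scoped HolderSpace

/-! ### The normalised squared distances, as a family of Hölder functions -/

section Family

variable {N : ℕ} {β γ : ℝ} {Λ : Set (E N)}

/-- The parameters of the kernels: a vector `p`, a direction `σ` and a relative radius `t`. -/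
abbrev Param (Λ : Set (E N)) : Type := Λ × (S N × unitInterval)

/-- The family `x ↦ f x • h` given by a bounded scalar function `f` and a Hölder function `h`. -/
def scaledFamily (f : Param Λ → ℝ) (hf : Continuous f) (C : ℝ) (hC : ∀ x, |f x| ≤ C)
    (h : HolderSpace N γ) : Param Λ →ᵇ HolderSpace N γ :=
  BoundedContinuousFunction.ofNormedAddCommGroup (fun x => f x • h) (hf.smul continuous_const)
    (C * ‖h‖) fun x => by
      rw [norm_smul]
      exact mul_le_mul_of_nonneg_right (hC x) (norm_nonneg h)

theorem scaledFamily_apply (f : Param Λ → ℝ) (hf : Continuous f) (C : ℝ) (hC : ∀ x, |f x| ≤ C)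
    (h : HolderSpace N γ) (x : Param Λ) (θ : S N) :
    scaledFamily f hf C hC h x θ = f x * h θ := rfl

theorem norm_scaledFamily_le (f : Param Λ → ℝ) (hf : Continuous f) {C : ℝ} (h0 : 0 ≤ C)
    (hC : ∀ x, |f x| ≤ C) (h : HolderSpace N γ) : ‖scaledFamily f hf C hC h‖ ≤ C * ‖h‖ :=
  norm_ofNormedAddCommGroup_le _ (by positivity) _

theorem C1Space.continuous_coe (φ : C1Space N β) : Continuous (φ : S N → ℝ) := by
  refine (LipschitzWith.of_dist_le_mul (K := (4 * ‖φ‖).toNNReal) fun θ σ => ?_).continuous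
  rw [Real.coe_toNNReal _ (by positivity), Real.dist_eq]
  exact φ.abs_sub_le θ σ

/-- `φ ↦ ((p, σ, t) ↦ φ σ)`. -/
def directionFamily (Λ : Set (E N)) (β γ : ℝ) : C1Space N β →L[ℝ] (Param Λ →ᵇ HolderSpace N γ) :=
  LinearMap.mkContinuous
    { toFun := fun φ => scaledFamily (fun x => φ x.2.1)
        (φ.continuous_coe.comp (continuous_fst.comp continuous_snd)) ‖φ‖
        (fun x => φ.abs_apply_le_norm x.2.1) 1
      map_add' := fun φ ψ => by
        ext x θ
        exact add_mul (φ x.2.1) (ψ x.2.1) 1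
      map_smul' := fun c φ => by
        ext x θ
        exact mul_assoc c (φ x.2.1) 1 } ‖(1 : HolderSpace N γ)‖ fun φ =>
    (norm_scaledFamily_le (Λ := Λ) (fun x => φ x.2.1)
      (φ.continuous_coe.comp (continuous_fst.comp continuous_snd)) (norm_nonneg φ)
      (fun x => φ.abs_apply_le_norm x.2.1) (1 : HolderSpace N γ)).trans_eq (mul_comm _ _)

theorem directionFamily_apply (φ : C1Space N β) (x : Param Λ) (θ : S N) :
    directionFamily Λ β γ φ x θ = φ x.2.1 := mul_one (φ x.2.1)

/-- `φ ↦ ((p, σ, t) ↦ (θ ↦ φ θ))`. -/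
def constFamily (Λ : Set (E N)) (β : ℝ) (hγ : γ ≤ 1) :
    C1Space N β →L[ℝ] (Param Λ →ᵇ HolderSpace N γ) :=
  LinearMap.mkContinuous
    { toFun := fun φ => BoundedContinuousFunction.const (Param Λ) (inclusion N β hγ φ)
      map_add' := fun φ ψ => by
        ext x θ
        rfl
      map_smul' := fun c φ => by
        ext x θ
        rfl } ‖inclusion N β hγ‖ fun φ =>
    (norm_const_le _).trans ((inclusion N β hγ).le_opNorm φ)

theorem constFamily_apply (hγ : γ ≤ 1) (φ : C1Space N β) (x : Param Λ) (θ : S N) :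
    constFamily Λ β hγ φ x θ = φ θ := rfl

theorem abs_coord_le (x : E N) (j : Fin N) : |x j| ≤ ‖x‖ := by
  rw [← Real.norm_eq_abs]
  exact PiLp.norm_apply_le x j

theorem continuous_inv_norm {c : ℝ} (hc : 0 < c) (hΛ : ∀ p : Λ, c ≤ ‖(p : E N)‖) :
    Continuous fun x : Param Λ => ‖(x.1 : E N)‖⁻¹ :=
  (continuous_norm.comp (continuous_subtype_val.comp continuous_fst)).inv₀
    fun x => (hc.trans_le (hΛ x.1)).ne'

theorem inv_norm_le {c : ℝ} (hc : 0 < c) (hΛ : ∀ p : Λ, c ≤ ‖(p : E N)‖) (p : Λ) :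
    ‖(p : E N)‖⁻¹ ≤ c⁻¹ := inv_anti₀ hc (hΛ p)

variable {c : ℝ} (hc : 0 < c) (hΛ : ∀ p : Λ, c ≤ ‖(p : E N)‖)

/-- `(p, σ, t) ↦ t σⱼ / |p|`. -/
def sourceFamily (γ : ℝ) (j : Fin N) : Param Λ →ᵇ HolderSpace N γ :=
  scaledFamily (fun x => ‖(x.1 : E N)‖⁻¹ * ((x.2.2 : ℝ) * (x.2.1 : E N) j))
    ((continuous_inv_norm hc hΛ).mul (by fun_prop)) (c⁻¹ * (1 * 1)) (fun x => by
      rw [abs_mul, abs_mul, abs_of_nonneg (by positivity : 0 ≤ ‖(x.1 : E N)‖⁻¹),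
        abs_of_nonneg x.2.2.2.1]
      have h1 := abs_coord_le (x.2.1 : E N) j
      have h2 : ‖(x.2.1 : E N)‖ = 1 := by simp
      rw [h2] at h1
      exact mul_le_mul (inv_norm_le hc hΛ x.1)
        (mul_le_mul x.2.2.2.2 h1 (abs_nonneg _) zero_le_one)
        (mul_nonneg x.2.2.2.1 (abs_nonneg _)) (inv_pos.2 hc).le) 1

/-- `(p, σ, t) ↦ (θ ↦ θⱼ / |p|)`. -/
def targetFamily (hγ : γ ≤ 1) (j : Fin N) : Param Λ →ᵇ HolderSpace N γ :=
  scaledFamily (fun x => ‖(x.1 : E N)‖⁻¹) (continuous_inv_norm hc hΛ) c⁻¹ (fun x => by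
    rw [abs_of_nonneg (by positivity : 0 ≤ ‖(x.1 : E N)‖⁻¹)]
    exact inv_norm_le hc hΛ x.1) (coordFun hγ j)

/-- `(p, σ, t) ↦ pⱼ / |p|`. -/
def shiftFamily (γ : ℝ) (j : Fin N) : Param Λ →ᵇ HolderSpace N γ :=
  scaledFamily (fun x => ‖(x.1 : E N)‖⁻¹ * (x.1 : E N) j)
    ((continuous_inv_norm hc hΛ).mul (by fun_prop)) 1 (fun x => by
      have h0 : 0 < ‖(x.1 : E N)‖ := hc.trans_le (hΛ x.1)
      rw [abs_mul, abs_of_nonneg (by positivity : 0 ≤ ‖(x.1 : E N)‖⁻¹), inv_mul_le_iff₀ h0, mul_one]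
      exact abs_coord_le _ j) 1

/-- `(τ, φ) ↦ ((p, σ, t) ↦ (θ ↦ |τ (t F_φ(σ) - F_φ(θ)) + p|² / |p|²))`. -/
def distFamily (hγ : γ ≤ 1) (z : ℝ × C1Space N β) : Param Λ →ᵇ HolderSpace N γ :=
  ∑ j, (z.1 • ((1 + directionFamily Λ β γ z.2) * sourceFamily hc hΛ γ j -
    (1 + constFamily Λ β hγ z.2) * targetFamily hc hΛ hγ j) + shiftFamily hc hΛ γ j) ^ 2

/-- Squaring the distance makes it polynomial in `τ` and continuous linear images of `φ`; dividing
by `|p|²` keeps the coefficients bounded over all `p`. -/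
theorem contDiff_distFamily (hγ : γ ≤ 1) : ContDiff ℝ ∞ (distFamily (β := β) hc hΛ hγ) := by
  unfold distFamily
  refine ContDiff.sum fun j _ => ContDiff.pow (ContDiff.add (contDiff_fst.smul
    (ContDiff.sub (ContDiff.mul ?_ contDiff_const) (ContDiff.mul ?_ contDiff_const)))
      contDiff_const) 2
  · exact contDiff_const.add ((directionFamily Λ β γ).contDiff.comp contDiff_snd)
  · exact contDiff_const.add ((constFamily Λ β hγ).contDiff.comp contDiff_snd)

theorem distFamily_apply (hγ : γ ≤ 1) (z : ℝ × C1Space N β) (x : Param Λ) (θ : S N) :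
    distFamily hc hΛ hγ z x θ =
      (‖z.1 • ((x.2.2 : ℝ) • Fmap z.2 x.2.1 - Fmap z.2 θ) + x.1‖ / ‖(x.1 : E N)‖) ^ 2 := by
  have h0 : ‖(x.1 : E N)‖ ≠ 0 := (hc.trans_le (hΛ x.1)).ne'
  rw [div_pow, EuclideanSpace.norm_sq_eq, Finset.sum_div]
  change evalFamily γ x θ (distFamily hc hΛ hγ z) = _
  rw [distFamily, map_sum]
  refine Finset.sum_congr rfl fun j _ => ?_
  rw [map_pow, map_add, map_smul, map_sub, map_mul, map_mul, map_add, map_add, map_one]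
  change (z.1 • ((1 + directionFamily Λ β γ z.2 x θ) * sourceFamily hc hΛ γ j x θ -
    (1 + constFamily Λ β hγ z.2 x θ) * targetFamily hc hΛ hγ j x θ) +
      shiftFamily hc hΛ γ j x θ) ^ 2 = _
  rw [directionFamily_apply, constFamily_apply, sourceFamily, targetFamily, shiftFamily,
    scaledFamily_apply, scaledFamily_apply, scaledFamily_apply, Real.norm_eq_abs, sq_abs,
    ← div_pow]
  simp [Fmap]
  field_simp

/-- The bound is uniform in `p`, `σ`, `t` and `θ`, as `familyRpow` requires. -/
theorem le_distFamily_apply (hγ : γ ≤ 1) {z : ℝ × C1Space N β} (hφ : ∀ σ, |z.2 σ| < 1)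
    (hτ : |z.1| < c / 4) (x : Param Λ) (θ : S N) :
    (1 - 4 * |z.1| / c) ^ 2 ≤ distFamily hc hΛ hγ z x θ := by
  have hδ : 0 < 1 - 4 * |z.1| / c := by
    rw [sub_pos, div_lt_one hc]; linarith
  have h1 : ‖(x.2.2 : ℝ) • Fmap z.2 x.2.1‖ ≤ 2 := by
    rw [norm_smul, Real.norm_of_nonneg x.2.2.2.1]
    have := norm_Fmap_le hφ x.2.1
    have := x.2.2.2.2
    nlinarith [norm_nonneg (Fmap z.2 x.2.1)]
  rw [distFamily_apply]
  gcongr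
  rw [le_div_iff₀ (hc.trans_le (hΛ x.1))]
  exact mul_norm_le_norm_smul_sub_add hc (hΛ x.1) h1 (norm_Fmap_le hφ θ)

/-- `(τ, φ) ↦ ((p, σ, t) ↦ (θ ↦ (1 + φ σ)ᴺ (|τ (t F_φ(σ) - F_φ(θ)) + p| / |p|)^{-(N+α)}))`. -/
def kernelFamily (hγ : γ ≤ 1) (α : ℝ) (z : ℝ × C1Space N β) : Param Λ →ᵇ HolderSpace N γ :=
  (1 + directionFamily Λ β γ z.2) ^ N * familyRpow (-(((N : ℝ) + α) / 2)) (distFamily hc hΛ hγ z)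

theorem contDiffAt_kernelFamily (hγ : γ ≤ 1) (α : ℝ) {z : ℝ × C1Space N β}
    (hφ : ∀ σ, |z.2 σ| < 1) (hτ : |z.1| < c / 4) :
    ContDiffAt ℝ ∞ (kernelFamily (β := β) hc hΛ hγ α) z := by
  have hδ : 0 < 1 - 4 * |z.1| / c := by
    rw [sub_pos, div_lt_one hc]; linarith
  refine ContDiffAt.mul (ContDiff.contDiffAt ?_) (ContDiffAt.comp z
    (g := familyRpow (-(((N : ℝ) + α) / 2))) (contDiffAt_familyRpow (pow_pos hδ 2) (le_distFamily_apply hc hΛ hγ hφ hτ) _)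
    (contDiff_distFamily hc hΛ hγ).contDiffAt)
  exact ContDiff.pow (contDiff_const.add ((directionFamily Λ β γ).contDiff.comp contDiff_snd)) N

theorem kernelFamily_apply (hγ : γ ≤ 1) (α : ℝ) {z : ℝ × C1Space N β}
    (hφ : ∀ σ, |z.2 σ| < 1) (hτ : |z.1| < c / 4) (x : Param Λ) (θ : S N) :
    kernelFamily hc hΛ hγ α z x θ = (1 + z.2 x.2.1) ^ N *
      (‖(x.1 : E N)‖ ^ ((N : ℝ) + α) * kernel α x.1 z.1 z.2 θ ((x.2.2 : ℝ) • Fmap z.2 x.2.1)) := by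
  have hδ : 0 < 1 - 4 * |z.1| / c := by
    rw [sub_pos, div_lt_one hc]; linarith
  change evalFamily γ x θ (kernelFamily hc hΛ hγ α z) = _
  rw [kernelFamily, map_mul, map_pow, map_add, map_one]
  change (1 + directionFamily Λ β γ z.2 x θ) ^ N * familyRpow _ (distFamily hc hΛ hγ z) x θ = _
  rw [directionFamily_apply, familyRpow_apply (pow_pos hδ 2) (le_distFamily_apply hc hΛ hγ hφ hτ),
    distFamily_apply, kernel, ← Real.rpow_natCast _ 2, ← Real.rpow_mul (by positivity)]
  congr 1
  -- The halved exponent compensates for the squared distance.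
  rw [show ((2 : ℕ) : ℝ) * -(((N : ℝ) + α) / 2) = -((N : ℝ) + α) by push_cast; ring,
    Real.rpow_neg (by positivity), Real.div_rpow (norm_nonneg _) (norm_nonneg _), inv_div,
    div_eq_mul_one_div]

end Family

/-! ### Integration over the cone -/

section Integration

variable {N : ℕ} {γ : ℝ} {Λ : Set (E N)}

/-- With `p` fixed, the integrand is continuous on the compact space `S × [0,1]`. -/
theorem integrable_slice (b : Param Λ →ᵇ HolderSpace N γ) (p : Λ) :
    Integrable (fun x : S N × unitInterval => (x.2 : ℝ) ^ (N - 1) • b (p, x)) (coneMeasure N) :=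
  Continuous.integrable_of_hasCompactSupport (by fun_prop) (HasCompactSupport.of_compactSpace _)

/-- `b ↦ -α |p|^{-(N+α)} ∫ t^{N-1} b(p, σ, t) d(σ, t)`. -/
def coneIntegral (α γ : ℝ) (p : Λ) : (Param Λ →ᵇ HolderSpace N γ) →L[ℝ] HolderSpace N γ :=
  (-α * ‖(p : E N)‖ ^ (-((N : ℝ) + α))) • LinearMap.mkContinuous
    { toFun := fun b => ∫ x : S N × unitInterval, (x.2 : ℝ) ^ (N - 1) • b (p, x) ∂coneMeasure N
      map_add' := fun b b' => by
        rw [← integral_add (integrable_slice b p) (integrable_slice b' p)]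
        simp only [BoundedContinuousFunction.add_apply, smul_add]
      map_smul' := fun c b => by
        rw [RingHom.id_apply, ← integral_smul]
        simp only [BoundedContinuousFunction.smul_apply, smul_comm c] }
    ((coneMeasure N).real univ) fun b => by
      rw [mul_comm]
      refine norm_integral_le_of_norm_le_const (Filter.Eventually.of_forall fun x => ?_)
      rw [norm_smul, norm_pow, Real.norm_of_nonneg x.2.2.1]
      calc _ ≤ 1 * ‖b‖ := mul_le_mul (pow_le_one₀ x.2.2.1 x.2.2.2) (b.norm_coe_le_norm _)
            (norm_nonneg _) zero_le_one
        _ = ‖b‖ := one_mul _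

theorem norm_coneIntegral_le (α γ : ℝ) (p : Λ) : ‖coneIntegral α γ p‖ ≤
    (|α| * (coneMeasure N).real univ) * ‖(p : E N)‖ ^ (-((N : ℝ) + α)) := by
  rw [coneIntegral, norm_smul, norm_mul, norm_neg, Real.norm_eq_abs,
    Real.norm_of_nonneg (by positivity : 0 ≤ ‖(p : E N)‖ ^ (-((N : ℝ) + α)))]
  calc _ ≤ |α| * ‖(p : E N)‖ ^ (-((N : ℝ) + α)) * (coneMeasure N).real univ := by
        gcongr
        exact LinearMap.mkContinuous_norm_le _ measureReal_nonneg _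
    _ = _ := by ring

/-- Evaluation at `θ` is a continuous linear form, so it passes through the Bochner integral. -/
theorem coneIntegral_apply (α : ℝ) (p : Λ) (b : Param Λ →ᵇ HolderSpace N γ) (θ : S N) :
    coneIntegral α γ p b θ = -α * ‖(p : E N)‖ ^ (-((N : ℝ) + α)) *
      ∫ x : S N × unitInterval, (x.2 : ℝ) ^ (N - 1) * b (p, x) θ ∂coneMeasure N :=
  congrArg (-α * ‖(p : E N)‖ ^ (-((N : ℝ) + α)) * ·)
    ((HolderSpace.evalCLM γ θ).integral_comp_comm (integrable_slice b p)).symm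

theorem integrable_slice_apply (b : Param Λ →ᵇ HolderSpace N γ) (p : Λ) (θ : S N) :
    Integrable (fun x : S N × unitInterval => (x.2 : ℝ) ^ (N - 1) * b (p, x) θ) (coneMeasure N) :=
  (HolderSpace.evalCLM γ θ).integrable_comp (integrable_slice b p)

variable {β c : ℝ} (hc : 0 < c) (hΛ : ∀ p : Λ, c ≤ ‖(p : E N)‖)

/-- The weight `|p|^{-(N+α)}` in `coneIntegral` cancels the normalisation of the kernel; what
remains is `G_p` in polar coordinates. -/
theorem coneIntegral_kernelFamily_apply (hN : 1 ≤ N) (hγ : γ ≤ 1) {α : ℝ} (hα : 0 < α)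
    {z : ℝ × C1Space N β} (hφ : ∀ σ, |z.2 σ| < 1) (hτ : |z.1| < c / 4) (p : Λ) (θ : S N) :
    coneIntegral α γ p (kernelFamily hc hΛ hγ α z) θ = Gval α (p : E N) z.1 z.2 θ := by
  have hp : 0 < ‖(p : E N)‖ := hc.trans_le (hΛ p)
  have hpp : ‖(p : E N)‖ ^ (-((N : ℝ) + α)) * ‖(p : E N)‖ ^ ((N : ℝ) + α) = 1 := by
    rw [← Real.rpow_add hp]; simp
  have heq : ∀ x : S N × unitInterval, ‖(p : E N)‖ ^ (-((N : ℝ) + α)) *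
      ((x.2 : ℝ) ^ (N - 1) * kernelFamily hc hΛ hγ α z (p, x) θ) =
      (1 + z.2 x.1) ^ N * (x.2 : ℝ) ^ (N - 1) *
        kernel α (p : E N) z.1 z.2 θ ((x.2 : ℝ) • Fmap z.2 x.1) := fun x => by
    rw [kernelFamily_apply hc hΛ hγ α hφ hτ]
    dsimp only
    linear_combination ((1 + z.2 x.1) ^ N * (x.2 : ℝ) ^ (N - 1) *
      kernel α (p : E N) z.1 z.2 θ ((x.2 : ℝ) • Fmap z.2 x.1)) * hpp
  have hint := (integrable_slice_apply (kernelFamily hc hΛ hγ α z) p θ).const_mul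
    (‖(p : E N)‖ ^ (-((N : ℝ) + α)))
  simp only [heq] at hint
  rw [coneIntegral_apply, Gval, setIntegral_Bset hN z.2.2.1 hφ
    (integrableOn_kernel hN z.2.2.1 hφ hα hc (hΛ p) hτ θ) hint, mul_assoc, ← integral_const_mul]
  simp only [heq]

end Integration

end NearSphere
end

/-! ### Smoothness of each term and of the lattice sum -/

theorem proposition2p2 (N M : ℕ) (hN : 2 ≤ N) (hM : 1 ≤ M) (hMN : M ≤ N)
    (α β : ℝ) (hα : 0 < α) (hαβ : α < β) (hβ : β < 1)
    (a : Module.Basis (Fin M) ℝ (NearSphere.E M)) :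
    -- the integrals defining `G_p` converge on the whole domain
    (∀ p ∈ NearSphere.latticeStar N a, ∀ z ∈ NearSphere.domain N β a, ∀ θ : NearSphere.S N,
      IntegrableOn (NearSphere.kernel α p z.1 z.2 θ) (NearSphere.Bset (z.2 : NearSphere.S N → ℝ))) ∧
    -- they define maps `G_p` from the domain into `C^{β-α}(S)`
    ∃ G : NearSphere.latticeStar N a → ℝ × NearSphere.C1Space N β →
        NearSphere.HolderSpace N (β - α),
      (∀ p, ∀ z ∈ NearSphere.domain N β a, ∀ θ : NearSphere.S N,
        G p z θ = NearSphere.Gval α (p : NearSphere.E N) z.1 z.2 θ) ∧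
      -- each `G_p` is of class `C^∞`
      (∀ p, ContDiffOn ℝ ∞ (G p) (NearSphere.domain N β a)) ∧
      -- the lattice sum converges in `C^{β-α}(S)` and is of class `C^∞`
      (∀ z ∈ NearSphere.domain N β a, Summable fun p => G p z) ∧
      ContDiffOn ℝ ∞ (fun z => ∑' p, G p z) (NearSphere.domain N β a) := by
  have hN1 : 1 ≤ N := by omega
  have hγ : β - α ≤ 1 := by linarith
  have hφ : ∀ z ∈ NearSphere.domain N β a, ∀ σ, |z.2 σ| < 1 := fun z hz σ =>
    (z.2.abs_apply_le σ).trans_lt hz.2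
  have hτ : ∀ z ∈ NearSphere.domain N β a, |z.1| < NearSphere.c₀ N a / 4 := fun z hz =>
    abs_lt.2 hz.1
  have hΛ := NearSphere.c₀_le_norm (N := N) a
  have hc : 0 < NearSphere.c₀ N a := NearSphere.c₀_pos hM hMN a
  refine ⟨fun p hp z hz θ => NearSphere.integrableOn_kernel hN1 z.2.2.1 (hφ z hz) hα hc
    (hΛ ⟨p, hp⟩) (hτ z hz) θ, fun p z => NearSphere.coneIntegral α (β - α) p
      (NearSphere.kernelFamily hc hΛ hγ α z), fun p z hz θ =>
      NearSphere.coneIntegral_kernelFamily_apply hc hΛ hN1 hγ hα (hφ z hz) (hτ z hz) p θ, ?_⟩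
  have hK : ContDiffOn ℝ ∞ (NearSphere.kernelFamily hc hΛ hγ α) (NearSphere.domain N β a) :=
    fun z hz => (NearSphere.contDiffAt_kernelFamily hc hΛ hγ α (hφ z hz)
      (hτ z hz)).contDiffWithinAt
  -- The operators themselves are summed in operator norm, independently of `(τ, φ)`; evaluating at
  -- `K(τ, φ)` then gives the series of the `G_p`.
  have hs : Summable fun p : NearSphere.latticeStar N a =>
      NearSphere.coneIntegral (N := N) α (β - α) p :=
    Summable.of_norm_bounded ((NearSphere.summable_latticeStar_rpow hMN hα a).mul_left _)
      (NearSphere.norm_coneIntegral_le α (β - α))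
  have hsum := fun z => hs.hasSum.mapL
    (ContinuousLinearMap.apply ℝ _ (NearSphere.kernelFamily (β := β) hc hΛ hγ α z))
  refine ⟨fun p => (NearSphere.coneIntegral α (β - α) p).contDiff.comp_contDiffOn hK,
    fun z _ => (hsum z).summable, ?_⟩
  -- The sum is a single continuous linear map after the smooth `kernelFamily`.
  refine ContDiffOn.congr
    ((∑' p, NearSphere.coneIntegral (N := N) α (β - α) p).contDiff.comp_contDiffOn hK)
    fun z _ => (hsum z).tsum_eq
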